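/- Let $\mathbb{D}=\{z\in\mathbb{C}:|z|<1\}$ and let $\mathcal{A}_0$ be the set of functions $f$ analytic in $\mathbb{D}$ with $f(0)=1$. For $-\pi/2<\lambda<\pi/2$ put $\mathcal{P}_\lambda=\{p\in\mathcal{A}_0:\ \operatorname{Re}\, e^{i\lambda}p(z)>0 \text{ for all } z\in\mathbb{D}\}$ and $p_\lambda(z)=\dfrac{1+e^{-2i\lambda}z}{1-z}$. Write $f\prec F$ if there is an analytic function $\omega$ in $\mathbb{D}$ with $\omega(0)=0$, $|\omega(z)|<1$ and $f(z)=F(\omega(z))$ for all $z\in\mathbb{D}$. For $f(z)=\sum_{n\ge 0}a_nz^n$ and $g(z)=\sum_{n\ge 0}b_nz^n$ analytic in $\mathbb{D}$ let $(f*g)(z)=\sum_{n\ge 0}a_nb_nz^n$; for $V\subset\mathcal{A}_0$ let $V^*=\{g\in\mathcal{A}_0:\ (f*g)(z)\neq 0 \text{ for all } f\in V,\ z\in\mathbb{D}\}$ and $V^{**}=(V^*)^*$. Theorem. Let $\lambda\in(-\pi/2,\pi/2)$ and $p\in\mathcal{A}_0$. The following conditions are equivalent: (i) $p\in\mathcal{P}_\lambda$;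 (ii) $\dfrac{e^{i\lambda}p-i\sin\lambda}{\cos\lambda}\in\mathcal{P}_0$; (iii) there is a Borel probability measure $\mu$ on $\partial\mathbb{D}$ such that $p(z)=\displaystyle\int_{\partial\mathbb{D}}\frac{1+e^{-2i\lambda}xz}{1-xz}\,d\mu(x)$ for all $z\in\mathbb{D}$; (iv) $p\prec p_\lambda$ in $\mathbb{D}$; (v) $p\in V_\lambda^{*}$, where $V_\lambda=\left\{z\mapsto\dfrac{1+\frac{1-e^{-2i\lambda}x}{(1+e^{-2i\lambda})x}\,z}{1-z}:\ |x|=1\right\}$; (vi) $p\in W_\lambda^{**}$, where $W_\lambda=\left\{z\mapsto t\,\dfrac{1+xe^{-2i\lambda}z}{1-xz}+(1-t)\,\dfrac{1+ye^{-2i\lambda}z}{1-yz}:\ |x|=|y|=1,\ 0\le t\le 1\right\}$. -/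

import Mathlib

namespace TiltedCaratheodory

noncomputable section

/-- The open unit disc. -/
def disc : Set ℂ := Metric.ball 0 1

/-- Functions analytic in the unit disc with value `1` at the origin.  Functions on the disc are
represented by total functions `ℂ → ℂ`; values outside the disc play no role. -/
def A₀ : Set (ℂ → ℂ) := {f | AnalyticOnNhd ℂ f disc ∧ f 0 = 1}

/-- The tilted Carathéodory class by angle `lam`. -/
def P (lam : ℝ) : Set (ℂ → ℂ) :=
  {p | p ∈ A₀ ∧ ∀ z ∈ disc, 0 < (Complex.exp (Complex.I * lam) * p z).re}

/-- Subordination of functions analytic in the unit disc. -/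
def Subordinate (f F : ℂ → ℂ) : Prop :=
  ∃ ω : ℂ → ℂ, AnalyticOnNhd ℂ ω disc ∧ ω 0 = 0 ∧ (∀ z ∈ disc, ‖ω z‖ < 1) ∧
    ∀ z ∈ disc, f z = F (ω z)

/-- The function `(1 + e^{-2i lam} z) / (1 - z)`. -/
def pLam (lam : ℝ) (z : ℂ) : ℂ :=
  (1 + Complex.exp (-2 * Complex.I * lam) * z) / (1 - z)

/-- The `n`-th Taylor coefficient at the origin. -/
def taylorCoeff (f : ℂ → ℂ) (n : ℕ) : ℂ := iteratedDeriv n f 0 / (n.factorial : ℂ)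

/-- Convolution (Hadamard product); for functions analytic in the unit disc the series converges
at every point of the disc. -/
def hadamard (f g : ℂ → ℂ) (z : ℂ) : ℂ := ∑' n : ℕ, taylorCoeff f n * taylorCoeff g n * z ^ n

/-- The dual set of a family with respect to convolution. -/
def dual (V : Set (ℂ → ℂ)) : Set (ℂ → ℂ) :=
  {g | g ∈ A₀ ∧ ∀ f ∈ V, ∀ z ∈ disc, hadamard f g z ≠ 0}

/-- The family `V_lam`. -/
def V (lam : ℝ) : Set (ℂ → ℂ) :=
  {f | ∃ x : ℂ, ‖x‖ = 1 ∧ f = fun z =>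
    (1 + (1 - Complex.exp (-2 * Complex.I * lam) * x) /
      ((1 + Complex.exp (-2 * Complex.I * lam)) * x) * z) / (1 - z)}

/-- The family `W_lam`. -/
def W (lam : ℝ) : Set (ℂ → ℂ) :=
  {f | ∃ (x y : ℂ) (t : ℝ), ‖x‖ = 1 ∧ ‖y‖ = 1 ∧ 0 ≤ t ∧ t ≤ 1 ∧ f = fun z =>
    (t : ℂ) * ((1 + x * Complex.exp (-2 * Complex.I * lam) * z) / (1 - x * z)) +
      (1 - (t : ℂ)) * ((1 + y * Complex.exp (-2 * Complex.I * lam) * z) / (1 - y * z))}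

end

end TiltedCaratheodory

namespace TiltedCaratheodory

open MeasureTheory Metric Filter Topology

/-! Write `e` for e^{-2i lam}. Conditions (i)-(iii) are one fact up to an affine change of variable:
(ii) normalises the tilted half plane to the right half plane, `herglotz` gives the measure, and
averaging values of `pLam` stays in the half plane. For (iv) and (v) the key is
`norm_add_sq_sub_norm_sub_sq`: the half plane is the set of points closer to 1 than to -e. Hence (p
- 1)/(e + p) is the subordinating function, and convolution with a member of `V lam` vanishes
exactly when p = p(z) satisfies x(e + p) = 1 - p with |x| = 1, that is, on the boundary line. For
(iii) → (vi), g * p at z is the μ-average of H(xz), where H = g * `pLam` = 1 + (1 + e)(g - 1). That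
g is dual to `W lam` says that no chord of the closed curve x ↦ H(xz) meets 0; such a curve lies in
an open half plane, so its average is nonzero (`integral_ne_zero_of_no_opposite`). Finally (vi) →
(v) is formal: `W lam` lies in the dual of `V lam`, so `V lam` lies in the dual of `W lam`, and
duality reverses inclusions. -/

theorem mem_disc {z : ℂ} : z ∈ disc ↔ ‖z‖ < 1 := mem_ball_zero_iff

theorem zero_mem_disc : (0 : ℂ) ∈ disc := by simp [mem_disc]

theorem isOpen_disc : IsOpen disc := isOpen_ball

theorem mul_mem_disc {x z : ℂ} (hx : ‖x‖ = 1) (hz : z ∈ disc) : x * z ∈ disc := by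
  simpa [mem_disc, hx] using hz

theorem one_sub_ne_zero {z : ℂ} (hz : z ∈ disc) : 1 - z ≠ 0 := by
  intro h
  rw [mem_disc, ← sub_eq_zero.1 h] at hz
  simp at hz

/-! ### Taylor coefficients and convolution -/

theorem hasSum_of_eq {a b : ℕ → ℂ} {s t : ℂ} (h : HasSum a s) (hab : ∀ n, b n = a n)
    (hst : t = s) : HasSum b t := by
  rwa [funext hab, hst]

theorem hasSum_taylorCoeff {f : ℂ → ℂ} (hf : AnalyticOnNhd ℂ f disc) {z : ℂ} (hz : z ∈ disc) :
    HasSum (fun n => taylorCoeff f n * z ^ n) (f z) := by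
  refine hasSum_of_eq (Complex.hasSum_taylorSeries_on_ball (c := 0) (r := 1) hf.differentiableOn hz)
    (fun n => ?_) rfl
  simp only [taylorCoeff, smul_eq_mul, sub_zero]
  ring

theorem taylorCoeff_of_hasSum {f : ℂ → ℂ} {a : ℕ → ℂ}
    (hf : ∀ z ∈ disc, HasSum (fun n => a n * z ^ n) (f z)) : taylorCoeff f = a := by
  have h1 : HasFPowerSeriesAt f (FormalMultilinearSeries.ofScalars ℂ a) 0 := by
    rw [hasFPowerSeriesAt_iff]
    filter_upwards [isOpen_disc.mem_nhds zero_mem_disc] with z hz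
    simpa [FormalMultilinearSeries.coeff_ofScalars, mul_comm] using hf z hz
  have h2 := h1.analyticAt.hasFPowerSeriesAt
  have h3 := h2.eq_formalMultilinearSeries h1
  ext n
  have := congrArg (fun q => q.coeff n) h3
  simpa [FormalMultilinearSeries.coeff_ofScalars, taylorCoeff] using this

theorem taylorCoeff_zero {f : ℂ → ℂ} (hf : f ∈ A₀) : taylorCoeff f 0 = 1 := by
  simp [taylorCoeff, hf.2]

theorem hadamard_eq_of_hasSum {f g : ℂ → ℂ} {z s : ℂ}
    (h : HasSum (fun n => taylorCoeff f n * taylorCoeff g n * z ^ n) s) : hadamard f g z = s :=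
  h.tsum_eq

theorem hadamard_comm (f g : ℂ → ℂ) : hadamard f g = hadamard g f := by
  ext z
  simp only [hadamard, mul_comm (taylorCoeff f _)]

/-- The Taylor coefficients of `(1 + c z) / (1 - z)`. -/
def mobiusCoeff (c : ℂ) (n : ℕ) : ℂ := if n = 0 then 1 else 1 + c

/-- Every coefficient of g is multiplied by 1 + c except the constant one, which is 1; subtracting c
corrects it. -/
theorem hasSum_mobiusCoeff_mul {g : ℂ → ℂ} (hg : g ∈ A₀) (c : ℂ) {z : ℂ} (hz : z ∈ disc) :
    HasSum (fun n => mobiusCoeff c n * taylorCoeff g n * z ^ n) (1 + (1 + c) * (g z - 1)) := by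
  have h := ((hasSum_taylorCoeff hg.1 hz).mul_left (1 + c)).sub (hasSum_ite_eq (0 : ℕ) c)
  refine hasSum_of_eq h (fun n => ?_) ?_
  · by_cases hn : n = 0
    · subst hn
      simp [mobiusCoeff, taylorCoeff_zero hg]
    · simp [mobiusCoeff, hn]
      ring
  · ring

theorem hasSum_mobius (c : ℂ) {z : ℂ} (hz : z ∈ disc) :
    HasSum (fun n => mobiusCoeff c n * z ^ n) ((1 + c * z) / (1 - z)) := by
  have h := ((hasSum_geometric_of_norm_lt_one (mem_disc.1 hz)).mul_left (1 + c)).sub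
    (hasSum_ite_eq (0 : ℕ) c)
  refine hasSum_of_eq h (fun n => ?_) ?_
  · by_cases hn : n = 0
    · subst hn
      simp [mobiusCoeff]
    · simp [mobiusCoeff, hn]
  · have := one_sub_ne_zero hz
    field_simp
    ring

theorem mobius_mem_A₀ (c : ℂ) : (fun z => (1 + c * z) / (1 - z)) ∈ A₀ := by
  refine ⟨fun z hz => ?_, by simp⟩
  have := one_sub_ne_zero hz
  fun_prop (disch := assumption)

theorem taylorCoeff_mobius (c : ℂ) :
    taylorCoeff (fun z => (1 + c * z) / (1 - z)) = mobiusCoeff c :=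
  taylorCoeff_of_hasSum fun _ hz => hasSum_mobius c hz

theorem hadamard_mobius {g : ℂ → ℂ} (hg : g ∈ A₀) (c : ℂ) {z : ℂ} (hz : z ∈ disc) :
    hadamard (fun z => (1 + c * z) / (1 - z)) g z = 1 + (1 + c) * (g z - 1) := by
  apply hadamard_eq_of_hasSum
  rw [taylorCoeff_mobius]
  exact hasSum_mobiusCoeff_mul hg c hz

theorem taylorCoeff_mobius_mixture (e x y s t : ℂ) (hx : ‖x‖ = 1) (hy : ‖y‖ = 1) :
    taylorCoeff (fun z => s * ((1 + x * e * z) / (1 - x * z)) + t * ((1 + y * e * z) / (1 - y * z)))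
      = fun n => (s * x ^ n + t * y ^ n) * mobiusCoeff e n := by
  refine taylorCoeff_of_hasSum fun z hz => ?_
  have h := ((hasSum_mobius e (mul_mem_disc hx hz)).mul_left s).add
    ((hasSum_mobius e (mul_mem_disc hy hz)).mul_left t)
  refine hasSum_of_eq h (fun n => ?_) ?_
  · simp only [mul_pow]
    ring
  · rw [mul_comm x e, mul_comm y e, mul_assoc, mul_assoc]

theorem hadamard_mobius_mixture {g : ℂ → ℂ} (hg : g ∈ A₀) (e x y s t : ℂ) (hx : ‖x‖ = 1)
    (hy : ‖y‖ = 1) {z : ℂ} (hz : z ∈ disc) :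
    hadamard (fun z => s * ((1 + x * e * z) / (1 - x * z)) + t * ((1 + y * e * z) / (1 - y * z))) g z
      = s * (1 + (1 + e) * (g (x * z) - 1)) + t * (1 + (1 + e) * (g (y * z) - 1)) := by
  apply hadamard_eq_of_hasSum
  rw [taylorCoeff_mobius_mixture e x y s t hx hy]
  have h := ((hasSum_mobiusCoeff_mul hg e (mul_mem_disc hx hz)).mul_left s).add
    ((hasSum_mobiusCoeff_mul hg e (mul_mem_disc hy hz)).mul_left t)
  refine hasSum_of_eq h (fun n => ?_) rfl
  simp only [mul_pow]
  ring

/-- The rotations of a function analytic in the disc, averaged against a probability measure on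
the circle, have Taylor coefficients multiplied by the moments of the measure. -/
theorem hasSum_moment_mul_taylorCoeff {g : ℂ → ℂ} (hg : AnalyticOnNhd ℂ g disc)
    (μ : Measure (sphere (0 : ℂ) 1)) [IsProbabilityMeasure μ] {z : ℂ} (hz : z ∈ disc) :
    HasSum (fun n => (∫ x, (x : ℂ) ^ n ∂μ) * taylorCoeff g n * z ^ n)
      (∫ x, g ((x : ℂ) * z) ∂μ) := by
  have hnorm : ∀ x : sphere (0 : ℂ) 1, ‖(x : ℂ)‖ = 1 := fun x => by simp
  have key := hasSum_integral_of_summable_integral_norm (μ := μ)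
    (F := fun n (x : sphere (0 : ℂ) 1) => taylorCoeff g n * ((x : ℂ) * z) ^ n)
    (fun n => Continuous.integrable_of_hasCompactSupport (by fun_prop)
      (HasCompactSupport.of_compactSpace _)) (by
      -- Since |x| = 1, the norms of the terms do not depend on x.
      have hs : Summable fun n => ‖taylorCoeff g n * z ^ n‖ :=
        (hasSum_taylorCoeff hg hz).summable.norm
      simpa [mul_pow, hnorm] using hs)
  refine hasSum_of_eq key (fun n => ?_) ?_
  · rw [integral_const_mul]
    simp only [mul_pow]
    rw [integral_mul_const]
    ring
  · refine integral_congr_ae (Eventually.of_forall fun x => ?_)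
    exact ((hasSum_taylorCoeff hg (mul_mem_disc (hnorm x) hz)).tsum_eq).symm

/-! ### Curves without opposite points lie in a half plane -/

/-- A continuous map from a connected compact space to the plane, no chord of whose image contains
the origin, takes its values in an open half plane bounded by a line through the origin. -/
theorem exists_re_mul_pos {X : Type*} [TopologicalSpace X] [ConnectedSpace X] [CompactSpace X]
    {h : X → ℂ} (hc : Continuous h)
    (hseg : ∀ (x y : X) (t : ℝ), 0 ≤ t → t ≤ 1 → (t : ℂ) * h x + (1 - (t : ℂ)) * h y ≠ 0) :
    ∃ a : ℂ, ∀ x, 0 < (a * h x).re := by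
  -- Homogeneous form of the chord condition; s = 0 gives that `h` has no zero.
  have hopp : ∀ (x y : X) (r s : ℝ), 0 < r → 0 ≤ s → (r : ℂ) * h x + (s : ℂ) * h y ≠ 0 := by
    intro x y r s hr hs h0
    have hrs : (r : ℂ) + s ≠ 0 := by
      exact_mod_cast (by positivity : r + s ≠ 0)
    refine hseg x y (r / (r + s)) (by positivity) (by rw [div_le_one (by positivity)]; linarith) ?_
    push_cast
    field_simp
    linear_combination h0
  have hne : ∀ x, h x ≠ 0 := fun x hx => hopp x x 1 0 one_pos le_rfl (by simp [hx])
  obtain ⟨y₀⟩ := (inferInstance : Nonempty X)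
  -- A quotient on the closed negative axis would put 0 on a chord, so the principal argument of the
  -- quotient is continuous.
  have hslit : ∀ x, h x / h y₀ ∈ Complex.slitPlane := by
    intro x
    rw [Complex.mem_slitPlane_iff_not_le_zero]
    intro hle
    have hre : h x / h y₀ = ((h x / h y₀).re : ℂ) := by
      apply Complex.ext <;> simp [(Complex.le_def.1 hle).2]
    have hle' : (h x / h y₀).re ≤ 0 := (Complex.le_def.1 hle).1
    refine hopp x y₀ 1 (-(h x / h y₀).re) one_pos (by linarith) ?_
    push_cast
    rw [← hre]
    have := hne y₀
    field_simp
    ring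
  have hθ : Continuous fun x => Complex.arg (h x / h y₀) := by
    rw [continuous_iff_continuousAt]
    intro x
    exact ContinuousAt.comp' (f := fun x => h x / h y₀) (Complex.continuousAt_arg (hslit x))
      (hc.div_const _).continuousAt
  set θ : X → ℝ := fun x => Complex.arg (h x / h y₀) with hθdef
  obtain ⟨M, -, hM⟩ := isCompact_univ.exists_isMaxOn Set.univ_nonempty hθ.continuousOn
  obtain ⟨m, -, hm⟩ := isCompact_univ.exists_isMinOn Set.univ_nonempty hθ.continuousOn
  have hpolar : ∀ x, h x = (‖h x / h y₀‖ : ℂ) * Complex.exp (θ x * Complex.I) * h y₀ := by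
    intro x
    rw [hθdef, Complex.norm_mul_exp_arg_mul_I, div_mul_cancel₀ _ (hne y₀)]
  have hpos : ∀ x, 0 < ‖h x / h y₀‖ := fun x => norm_pos_iff.2 (div_ne_zero (hne x) (hne y₀))
  -- Otherwise some argument is exactly π below the maximum, which gives two opposite directions.
  have hlt : θ M - θ m < Real.pi := by
    by_contra! hge
    obtain ⟨x, hx⟩ : θ M - Real.pi ∈ Set.range θ :=
      mem_range_of_exists_le_of_exists_ge hθ ⟨m, by linarith⟩ ⟨M, by linarith [Real.pi_pos]⟩
    refine hopp x M ‖h M / h y₀‖ ‖h x / h y₀‖ (hpos M) (hpos x).le ?_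
    have hexp : Complex.exp (θ x * Complex.I) = -Complex.exp (θ M * Complex.I) := by
      rw [hx, Complex.ofReal_sub, sub_mul, Complex.exp_sub, Complex.exp_pi_mul_I]
      ring
    linear_combination (‖h M / h y₀‖ : ℂ) * hpolar x + (‖h x / h y₀‖ : ℂ) * hpolar M +
      (‖h M / h y₀‖ : ℂ) * (‖h x / h y₀‖ : ℂ) * h y₀ * hexp
  -- Rotating the middle of the range of arguments to 0 brings every argument into (-π/2, π/2).
  refine ⟨Complex.exp (-((θ M + θ m) / 2 : ℝ) * Complex.I) / h y₀, fun x => ?_⟩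
  have hxM : θ x ≤ θ M := hM (Set.mem_univ x)
  have hmx : θ m ≤ θ x := hm (Set.mem_univ x)
  have : Complex.exp (-((θ M + θ m) / 2 : ℝ) * Complex.I) / h y₀ * h x =
      (‖h x / h y₀‖ : ℂ) * Complex.exp ((θ x - (θ M + θ m) / 2 : ℝ) * Complex.I) := by
    conv_lhs => rw [hpolar x]
    rw [Complex.ofReal_sub, sub_eq_neg_add, add_mul, Complex.exp_add]
    have := hne y₀
    field_simp
  rw [this, Complex.re_ofReal_mul, Complex.exp_ofReal_mul_I_re]
  exact mul_pos (hpos x) (Real.cos_pos_of_mem_Ioo ⟨by linarith, by linarith⟩)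

theorem integral_ne_zero_of_no_opposite {X : Type*} [TopologicalSpace X] [ConnectedSpace X]
    [CompactSpace X] [MeasurableSpace X] [BorelSpace X]
    (μ : Measure X) [IsProbabilityMeasure μ] {h : X → ℂ} (hc : Continuous h)
    (hseg : ∀ (x y : X) (t : ℝ), 0 ≤ t → t ≤ 1 → (t : ℂ) * h x + (1 - (t : ℂ)) * h y ≠ 0) :
    ∫ x, h x ∂μ ≠ 0 := by
  obtain ⟨a, ha⟩ := exists_re_mul_pos hc hseg
  intro h0
  have hint : Integrable (fun x => a * h x) μ :=
    Continuous.integrable_of_hasCompactSupport (by fun_prop) (HasCompactSupport.of_compactSpace _)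
  have h1 : ∫ x, (a * h x).re ∂μ = 0 := by
    have : ∫ x, (a * h x).re ∂μ = (∫ x, a * h x ∂μ).re := integral_re hint
    rw [this, integral_const_mul, h0]
    simp
  have h2 := (integral_eq_zero_iff_of_nonneg (fun x => (ha x).le) hint.re).1 h1
  obtain ⟨x, hx⟩ := h2.exists
  exact (ha x).ne' hx

/-! ### The Herglotz representation -/

/-- Dilation gives analyticity up to the boundary, as the Schwarz formula requires. -/
theorem analyticOnNhd_dilate {q : ℂ → ℂ} (hq : AnalyticOnNhd ℂ q disc) {r : ℝ} (hr0 : 0 < r)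
    (hr1 : r < 1) : AnalyticOnNhd ℂ (fun z => q (r * z)) (closedBall 0 1) := by
  intro z hz
  have hmem : (r : ℂ) * z ∈ disc := by
    rw [mem_disc, norm_mul, Complex.norm_real, Real.norm_of_nonneg hr0.le]
    have := mem_closedBall_zero_iff.1 hz
    nlinarith
  exact AnalyticAt.fun_comp (hq _ hmem) (by fun_prop)

/-- The Schwarz integral formula on the unit circle. -/
theorem schwarz_formula {q : ℂ → ℂ} (hq : AnalyticOnNhd ℂ q (closedBall 0 1)) (h0 : q 0 = 1)
    {w : ℂ} (hw : w ∈ disc) :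
    Real.circleAverage (fun ζ => (1 + starRingEnd ℂ ζ * w) / (1 - starRingEnd ℂ ζ * w) *
      ((q ζ).re : ℂ)) 0 1 = q w := by
  have hqc : ContinuousOn q (sphere 0 1) := hq.continuousOn.mono sphere_subset_closedBall
  have hden : ∀ ζ ∈ closedBall (0 : ℂ) 1, 1 - starRingEnd ℂ w * ζ ≠ 0 := by
    intro ζ hζ
    refine one_sub_ne_zero (mem_disc.2 ?_)
    rw [norm_mul, Complex.norm_conj]
    have := mem_closedBall_zero_iff.1 hζ
    have := mem_disc.1 hw
    nlinarith [norm_nonneg w, norm_nonneg ζ]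
  have hden' : ∀ ζ ∈ sphere (0 : ℂ) 1, ζ - w ≠ 0 := by
    intro ζ hζ h
    have := mem_disc.1 hw
    rw [← sub_eq_zero.1 h, mem_sphere_zero_iff_norm.1 hζ] at this
    exact lt_irrefl _ this
  have hqd : DiffContOnCl ℂ q (ball 0 |1|) := by
    rw [abs_one]
    refine DifferentiableOn.diffContOnCl ?_
    rw [closure_ball _ one_ne_zero]
    exact hq.differentiableOn
  have hkd : AnalyticOnNhd ℂ (fun ζ => (1 - starRingEnd ℂ w * ζ)⁻¹ * q ζ) (closedBall 0 1) := by
    intro ζ hζ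
    have := hden ζ hζ
    have := hq ζ hζ
    fun_prop (disch := assumption)
  have hkd' : DiffContOnCl ℂ (fun ζ => (1 - starRingEnd ℂ w * ζ)⁻¹ * q ζ) (ball 0 |1|) := by
    rw [abs_one]
    refine DifferentiableOn.diffContOnCl ?_
    rw [closure_ball _ one_ne_zero]
    exact hkd.differentiableOn
  have hA := hqd.circleAverage_smul_div (w := w) (by simpa [disc] using hw)
  have hM := hqd.circleAverage
  have hK := hkd'.circleAverage
  have hqi : CircleIntegrable q 0 1 := ContinuousOn.circleIntegrable' (by simpa using hqc)
  have hki : CircleIntegrable (fun ζ => (1 - starRingEnd ℂ w * ζ)⁻¹ * q ζ) 0 1 :=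
    ContinuousOn.circleIntegrable'
      (by simpa using hkd.continuousOn.mono sphere_subset_closedBall)
  have hai : CircleIntegrable (fun ζ => ((ζ - 0) / (ζ - w)) • q ζ) 0 1 := by
    refine ContinuousOn.circleIntegrable' ?_
    rw [abs_one]
    have : ContinuousOn (fun ζ : ℂ => (ζ - 0) / (ζ - w)) (sphere 0 1) := by
      fun_prop (disch := assumption)
    exact this.smul hqc
  have hconj : ∀ f : ℂ → ℂ, CircleIntegrable f 0 1 →
      CircleIntegrable (fun ζ => starRingEnd ℂ (f ζ)) 0 1 ∧
      Real.circleAverage (fun ζ => starRingEnd ℂ (f ζ)) 0 1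
        = starRingEnd ℂ (Real.circleAverage f 0 1) := by
    intro f hf
    refine ⟨?_, (Complex.conjCLE : ℂ →L[ℝ] ℂ).circleAverage_comp_comm hf⟩
    have := intervalIntegrable_iff.1 hf
    exact intervalIntegrable_iff.2 ((Complex.conjCLE : ℂ →L[ℝ] ℂ).integrable_comp this)
  -- On the circle the conjugate of ζ is 1/ζ, so the kernel is 2ζ/(ζ - w) - 1. The three terms are a
  -- Cauchy integrand with average q(w), the conjugate of an analytic function with value 1 at 0,
  -- and Re q with average 1.
  have hsplit : Set.EqOn
      (fun ζ => (1 + starRingEnd ℂ ζ * w) / (1 - starRingEnd ℂ ζ * w) * ((q ζ).re : ℂ))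
      (fun ζ => (((ζ - 0) / (ζ - w)) • q ζ +
        starRingEnd ℂ ((1 - starRingEnd ℂ w * ζ)⁻¹ * q ζ)) -
        (1 / 2 : ℂ) • (q ζ + starRingEnd ℂ (q ζ))) (sphere 0 |1|) := by
    intro ζ hζ
    rw [abs_one] at hζ
    have h1 := hden' ζ hζ
    have hζn : ‖ζ‖ = 1 := mem_sphere_zero_iff_norm.1 hζ
    have h2 : ζ ≠ 0 := by
      intro h
      simp [h] at hζn
    have h3 : starRingEnd ℂ ζ = ζ⁻¹ := by
      rw [Complex.inv_def, Complex.normSq_eq_norm_sq, hζn]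
      simp
    simp only [smul_eq_mul, map_mul, map_inv₀, map_sub, map_one, Complex.conj_conj, sub_zero,
      Complex.re_eq_add_conj, h3]
    have h4 : 1 - w * ζ⁻¹ = (ζ - w) / ζ := by field_simp
    have h5 : 1 - ζ⁻¹ * w = (ζ - w) / ζ := by field_simp
    rw [h4, h5]
    field_simp
    ring
  have hi₁ : CircleIntegrable (fun ζ => ((ζ - 0) / (ζ - w)) • q ζ +
      starRingEnd ℂ ((1 - starRingEnd ℂ w * ζ)⁻¹ * q ζ)) 0 1 := hai.add (hconj _ hki).1
  have hi₂ : CircleIntegrable (fun ζ => (1 / 2 : ℂ) • (q ζ + starRingEnd ℂ (q ζ))) 0 1 :=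
    (hqi.add (hconj _ hqi).1).const_smul
  rw [Real.circleAverage_congr_sphere hsplit, Real.circleAverage_fun_sub hi₁ hi₂,
    Real.circleAverage_fun_add hai (hconj _ hki).1, Real.circleAverage_fun_smul,
    Real.circleAverage_fun_add hqi (hconj _ hqi).1, (hconj _ hki).2, (hconj _ hqi).2, hA, hM, hK,
    h0]
  simp
  ring

/-- A continuous probability density on the unit circle, seen as a measure on the conjugate
circle. -/
theorem exists_measure_of_density {u : ℂ → ℝ} (hu : ContinuousOn u (sphere 0 1))
    (hu0 : ∀ ζ ∈ sphere (0 : ℂ) 1, 0 ≤ u ζ) (hu1 : Real.circleAverage u 0 1 = 1) :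
    ∃ μ : ProbabilityMeasure (sphere (0 : ℂ) 1), ∀ g : ℂ → ℂ, ContinuousOn g (sphere 0 1) →
      ∫ x, g x ∂(μ : Measure (sphere (0 : ℂ) 1)) =
        Real.circleAverage (fun ζ => g (starRingEnd ℂ ζ) * (u ζ : ℂ)) 0 1 := by
  have hmem : ∀ θ : ℝ, circleMap 0 1 θ ∈ sphere (0 : ℂ) 1 := fun θ => by simp
  -- The conjugation matches the Schwarz kernel, which is written in the conjugate of ζ.
  let φ : ℝ → sphere (0 : ℂ) 1 := fun θ => ⟨starRingEnd ℂ (circleMap 0 1 θ), by simp⟩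
  have hφ : Continuous φ := by
    refine Continuous.subtype_mk ?_ _
    fun_prop
  have hd : Continuous fun θ => (u (circleMap 0 1 θ) / (2 * Real.pi)).toNNReal := by
    refine continuous_real_toNNReal.comp (Continuous.div_const ?_ _)
    exact hu.comp_continuous (by fun_prop) hmem
  let μ : Measure (sphere (0 : ℂ) 1) :=
    ((volume.restrict (Set.Ioc 0 (2 * Real.pi))).withDensity
      fun θ => ((u (circleMap 0 1 θ) / (2 * Real.pi)).toNNReal : ENNReal)).map φ
  have hint : ∀ g : ℂ → ℂ, ContinuousOn g (sphere 0 1) → ∫ x, g x ∂μ =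
        Real.circleAverage (fun ζ => g (starRingEnd ℂ ζ) * (u ζ : ℂ)) 0 1 := by
    intro g hg
    have hg' : Continuous fun x : sphere (0 : ℂ) 1 => g x := hg.domRestrict
    rw [integral_map hφ.aemeasurable hg'.aestronglyMeasurable,
      integral_withDensity_eq_integral_smul hd.measurable, Real.circleAverage,
      intervalIntegral.integral_of_le Real.two_pi_pos.le, ← integral_smul]
    refine integral_congr_ae (Eventually.of_forall fun θ => ?_)
    have : 0 ≤ u (circleMap 0 1 θ) / (2 * Real.pi) :=
      div_nonneg (hu0 _ (hmem θ)) Real.two_pi_pos.le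
    simp only [φ, NNReal.smul_def, Real.coe_toNNReal _ this, Complex.real_smul]
    push_cast
    ring
  have hprob : IsProbabilityMeasure μ := by
    have h1 := hint (fun _ => 1) continuousOn_const
    have h2 : Real.circleAverage (fun ζ => (1 : ℂ) * (u ζ : ℂ)) 0 1 = 1 := by
      have := Complex.ofRealCLM.circleAverage_comp_comm (f := u) (c := 0) (R := 1)
        (ContinuousOn.circleIntegrable' (by simpa using hu))
      rw [hu1] at this
      simpa [Function.comp_def] using this
    rw [h2] at h1
    have h3 : μ.real Set.univ = 1 := by simpa using h1
    exact ⟨(ENNReal.toReal_eq_one_iff _).1 h3⟩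
  exact ⟨⟨μ, hprob⟩, hint⟩

theorem herglotz_dilate {q : ℂ → ℂ} (hq : AnalyticOnNhd ℂ q disc) (h0 : q 0 = 1)
    (hre : ∀ z ∈ disc, 0 < (q z).re) {r : ℝ} (hr0 : 0 < r) (hr1 : r < 1) :
    ∃ μ : ProbabilityMeasure (sphere (0 : ℂ) 1), ∀ z ∈ disc,
      ∫ x : sphere (0 : ℂ) 1, (1 + (x : ℂ) * z) / (1 - (x : ℂ) * z)
        ∂(μ : Measure (sphere (0 : ℂ) 1)) = q (r * z) := by
  have hQ := analyticOnNhd_dilate hq hr0 hr1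
  have hQc : ContinuousOn (fun z => (q (r * z)).re) (sphere 0 1) :=
    Complex.continuous_re.comp_continuousOn (hQ.continuousOn.mono sphere_subset_closedBall)
  have hQ0 : q (r * 0) = 1 := by simpa using h0
  obtain ⟨μ, hμ⟩ := exists_measure_of_density hQc
    (fun ζ hζ => (hre _ (by
      rw [mem_disc, norm_mul, Complex.norm_real, Real.norm_of_nonneg hr0.le,
        mem_sphere_zero_iff_norm.1 hζ]
      linarith)).le) (by
      -- At w = 0 the kernel is 1, so the density has total mass q(0) = 1.
      have h := schwarz_formula hQ hQ0 zero_mem_disc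
      have h' := Complex.ofRealCLM.circleAverage_comp_comm (f := fun z => (q (r * z)).re)
        (c := 0) (R := 1) (ContinuousOn.circleIntegrable' (by simpa using hQc))
      simp only [mul_zero, add_zero, sub_zero, div_one, one_mul, h0] at h
      rw [Function.comp_def] at h'
      simp only [Complex.ofRealCLM_apply] at h'
      rw [h] at h'
      exact_mod_cast h'.symm)
  refine ⟨μ, fun z hz => ?_⟩
  rw [← schwarz_formula hQ hQ0 hz]
  refine hμ (fun x => (1 + x * z) / (1 - x * z)) ?_
  have : ∀ x ∈ sphere (0 : ℂ) 1, 1 - x * z ≠ 0 := fun x hx =>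
    one_sub_ne_zero (mul_mem_disc (mem_sphere_zero_iff_norm.1 hx) hz)
  fun_prop (disch := assumption)

/-- **Herglotz representation theorem.** -/
theorem herglotz {q : ℂ → ℂ} (hq : AnalyticOnNhd ℂ q disc) (h0 : q 0 = 1)
    (hre : ∀ z ∈ disc, 0 < (q z).re) :
    ∃ μ : ProbabilityMeasure (sphere (0 : ℂ) 1), ∀ z ∈ disc,
      q z = ∫ x : sphere (0 : ℂ) 1, (1 + (x : ℂ) * z) / (1 - (x : ℂ) * z)
        ∂(μ : Measure (sphere (0 : ℂ) 1)) := by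
  have hex : ∀ r : ℝ, ∃ μ : ProbabilityMeasure (sphere (0 : ℂ) 1), 0 < r → r < 1 → ∀ z ∈ disc,
      ∫ x : sphere (0 : ℂ) 1, (1 + (x : ℂ) * z) / (1 - (x : ℂ) * z)
        ∂(μ : Measure (sphere (0 : ℂ) 1)) = q (r * z) := by
    intro r
    by_cases hr : 0 < r ∧ r < 1
    · obtain ⟨μ, hμ⟩ := herglotz_dilate hq h0 hre hr.1 hr.2
      exact ⟨μ, fun _ _ => hμ⟩
    -- An arbitrary value, so that the family of measures is defined for every real r.
    · exact ⟨⟨Measure.dirac ⟨1, by simp⟩, inferInstance⟩, fun h1 h2 => absurd ⟨h1, h2⟩ hr⟩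
  choose μs hμs using hex
  -- Probability measures on the circle form a compact space, so an ultrafilter with r → 1⁻ yields a
  -- weak limit without passing to a subsequence.
  let F : Ultrafilter ℝ := Ultrafilter.of (𝓝[<] 1)
  have hF : (F : Filter ℝ) ≤ 𝓝[<] 1 := Ultrafilter.of_le _
  obtain ⟨μ, -, hμ⟩ := isCompact_univ.ultrafilter_le_nhds (F.map μs) (by simp)
  have hlim : Tendsto μs F (𝓝 μ) := hμ
  refine ⟨μ, fun z hz => ?_⟩
  have hne : ∀ x : sphere (0 : ℂ) 1, 1 - (x : ℂ) * z ≠ 0 := fun x =>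
    one_sub_ne_zero (mul_mem_disc (by simp) hz)
  let k : BoundedContinuousFunction (sphere (0 : ℂ) 1) ℂ := BoundedContinuousFunction.mkOfCompact
    ⟨fun x => (1 + (x : ℂ) * z) / (1 - (x : ℂ) * z), by fun_prop (disch := exact hne)⟩
  have h1 := (ProbabilityMeasure.tendsto_iff_forall_integral_rclike_tendsto ℂ).1 hlim k
  have h2 : Tendsto (fun r : ℝ => q (r * z)) F (𝓝 (q z)) := by
    have hc : ContinuousAt (fun r : ℝ => q (r * z)) 1 := by
      refine ContinuousAt.comp' (f := fun r : ℝ => (r : ℂ) * z) ?_ (by fun_prop)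
      simpa using (hq z hz).continuousAt
    have := hc.tendsto.mono_left (hF.trans nhdsWithin_le_nhds)
    simpa using this
  refine tendsto_nhds_unique h2 (h1.congr' ?_)
  have hev : ∀ᶠ r : ℝ in F, r ∈ Set.Ioo (0 : ℝ) 1 :=
    hF (Ioo_mem_nhdsLT one_pos)
  filter_upwards [hev] with r hr
  exact hμs r hr.1 hr.2 z hz

/-! ### The tilted half plane -/

theorem exp_I_mul (lam : ℝ) :
    Complex.exp (Complex.I * lam) = (Real.cos lam : ℂ) + (Real.sin lam : ℂ) * Complex.I := by
  rw [mul_comm, Complex.exp_mul_I]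
  push_cast
  rfl

theorem exp_I_mul_mul_exp_neg_two (lam : ℝ) :
    Complex.exp (Complex.I * lam) * Complex.exp (-2 * Complex.I * lam) =
      (Real.cos lam : ℂ) - (Real.sin lam : ℂ) * Complex.I := by
  rw [← Complex.exp_add, show Complex.I * lam + -2 * Complex.I * lam = ((-lam : ℝ) : ℂ) * Complex.I
    by push_cast; ring, Complex.exp_mul_I, ← Complex.ofReal_cos, ← Complex.ofReal_sin,
    Real.cos_neg, Real.sin_neg]
  push_cast
  ring

theorem norm_exp_I_mul (lam : ℝ) : ‖Complex.exp (Complex.I * lam)‖ = 1 := by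
  rw [mul_comm, Complex.norm_exp_ofReal_mul_I]

/-- Multiplication by the unimodular e^{i lam} sends 1 and -e^{-2i lam} to cos lam + i sin lam and
-cos lam + i sin lam, mirror images in the imaginary axis. -/
theorem norm_add_sq_sub_norm_sub_sq (lam : ℝ) (p : ℂ) :
    ‖Complex.exp (-2 * Complex.I * lam) + p‖ ^ 2 - ‖1 - p‖ ^ 2 =
      4 * Real.cos lam * (Complex.exp (Complex.I * lam) * p).re := by
  have h1 : ‖Complex.exp (-2 * Complex.I * lam) + p‖ =
      ‖((Real.cos lam : ℂ) - (Real.sin lam : ℂ) * Complex.I)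
        + Complex.exp (Complex.I * lam) * p‖ := by
    rw [← exp_I_mul_mul_exp_neg_two, ← mul_add, norm_mul, norm_exp_I_mul, one_mul]
  have h2 : ‖1 - p‖ = ‖((Real.cos lam : ℂ) + (Real.sin lam : ℂ) * Complex.I)
        - Complex.exp (Complex.I * lam) * p‖ := by
    rw [← exp_I_mul, ← mul_one_sub, norm_mul, norm_exp_I_mul, one_mul]
  rw [h1, h2]
  generalize Complex.exp (Complex.I * lam) * p = w
  rw [← Complex.normSq_eq_norm_sq, ← Complex.normSq_eq_norm_sq, Complex.normSq_apply,
    Complex.normSq_apply]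
  simp only [Complex.add_re, Complex.add_im, Complex.sub_re, Complex.sub_im, Complex.mul_re,
    Complex.mul_im, Complex.ofReal_re, Complex.ofReal_im, Complex.I_re, Complex.I_im]
  ring

theorem exp_add_ne_zero {lam : ℝ} (hc : 0 < Real.cos lam) {p : ℂ}
    (hp : 0 ≤ (Complex.exp (Complex.I * lam) * p).re) :
    Complex.exp (-2 * Complex.I * lam) + p ≠ 0 := by
  intro h
  have h1 : Complex.exp (Complex.I * lam) * Complex.exp (-2 * Complex.I * lam)
      + Complex.exp (Complex.I * lam) * p = 0 := by
    rw [← mul_add, h, mul_zero]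
  rw [exp_I_mul_mul_exp_neg_two] at h1
  have h2 := congrArg Complex.re h1
  simp only [Complex.add_re, Complex.sub_re, Complex.mul_re, Complex.ofReal_re, Complex.ofReal_im,
    Complex.I_re, Complex.I_im, Complex.zero_re] at h2 hp
  linarith

theorem one_add_exp_ne_zero {lam : ℝ} (hc : 0 < Real.cos lam) :
    1 + Complex.exp (-2 * Complex.I * lam) ≠ 0 := by
  rw [add_comm]
  refine exp_add_ne_zero hc ?_
  rw [mul_one, mul_comm, Complex.exp_ofReal_mul_I_re]
  exact hc.le

theorem exp_mul_pLam_re_pos {lam : ℝ} (hc : 0 < Real.cos lam) {w : ℂ} (hw : w ∈ disc) :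
    0 < (Complex.exp (Complex.I * lam) * pLam lam w).re := by
  have h1 := one_sub_ne_zero hw
  have h2 := norm_add_sq_sub_norm_sub_sq lam (pLam lam w)
  have h3 : Complex.exp (-2 * Complex.I * lam) + pLam lam w =
      (1 + Complex.exp (-2 * Complex.I * lam)) / (1 - w) := by
    rw [pLam]
    field_simp
    ring
  have h4 : 1 - pLam lam w = -((1 + Complex.exp (-2 * Complex.I * lam)) / (1 - w) * w) := by
    rw [pLam]
    field_simp
    ring
  rw [h3, h4, norm_neg, norm_mul, mul_pow] at h2
  have h5 : 0 < ‖(1 + Complex.exp (-2 * Complex.I * lam)) / (1 - w)‖ ^ 2 :=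
    pow_pos (norm_pos_iff.2 (div_ne_zero (one_add_exp_ne_zero hc) h1)) 2
  have h6 : ‖w‖ ^ 2 < 1 := pow_lt_one₀ (norm_nonneg _) (mem_disc.1 hw) two_ne_zero
  by_contra! h7
  nlinarith [mul_nonneg hc.le (neg_nonneg.2 h7)]

theorem pLam_mem_A₀ (lam : ℝ) : pLam lam ∈ A₀ := mobius_mem_A₀ _

/-! ### The equivalences -/

theorem mem_P_iff_normalize_mem_P_zero {lam : ℝ} (hc : 0 < Real.cos lam) {p : ℂ → ℂ}
    (hp : p ∈ A₀) :
    p ∈ P lam ↔ (fun z => (Complex.exp (Complex.I * lam) * p z - Complex.I * (Real.sin lam : ℂ)) /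
        (Real.cos lam : ℂ)) ∈ P 0 := by
  have hc' : (Real.cos lam : ℂ) ≠ 0 := by exact_mod_cast hc.ne'
  have hA : (fun z => (Complex.exp (Complex.I * lam) * p z - Complex.I * (Real.sin lam : ℂ)) /
        (Real.cos lam : ℂ)) ∈ A₀ := by
    refine ⟨fun z hz => ?_, ?_⟩
    · have := hp.1 z hz
      fun_prop (disch := assumption)
    · simp only [hp.2, exp_I_mul, mul_one]
      field_simp
      ring
  have hre : ∀ z, (Complex.exp (Complex.I * (0 : ℝ)) *
      ((Complex.exp (Complex.I * lam) * p z - Complex.I * (Real.sin lam : ℂ)) /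
        (Real.cos lam : ℂ))).re = (Complex.exp (Complex.I * lam) * p z).re / Real.cos lam := by
    intro z
    rw [Complex.ofReal_zero, mul_zero, Complex.exp_zero, one_mul, Complex.div_ofReal_re,
      Complex.sub_re, Complex.re_mul_ofReal, Complex.I_re, zero_mul, sub_zero]
  constructor
  · exact fun h => ⟨hA, fun z hz => by rw [hre]; exact div_pos (h.2 z hz) hc⟩
  · refine fun h => ⟨hp, fun z hz => ?_⟩
    have := h.2 z hz
    rw [hre] at this
    exact (div_pos_iff_of_pos_right hc).1 this

theorem exists_measure_of_normalize_mem_P_zero {lam : ℝ} (hc : 0 < Real.cos lam) {p : ℂ → ℂ}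
    (h : (fun z => (Complex.exp (Complex.I * lam) * p z - Complex.I * (Real.sin lam : ℂ)) /
        (Real.cos lam : ℂ)) ∈ P 0) :
    ∃ μ : Measure (sphere (0 : ℂ) 1), IsProbabilityMeasure μ ∧ ∀ z ∈ disc,
      p z = ∫ x : sphere (0 : ℂ) 1,
        (1 + Complex.exp (-2 * Complex.I * lam) * (x : ℂ) * z) / (1 - (x : ℂ) * z) ∂μ := by
  obtain ⟨μ, hμ⟩ := herglotz h.1.1 h.1.2 (fun z hz => by simpa using h.2 z hz)
  refine ⟨μ, inferInstance, fun z hz => ?_⟩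
  have hc' : (Real.cos lam : ℂ) ≠ 0 := by exact_mod_cast hc.ne'
  have ha : Complex.exp (Complex.I * lam) ≠ 0 := Complex.exp_ne_zero _
  have hne : ∀ x : sphere (0 : ℂ) 1, 1 - (x : ℂ) * z ≠ 0 := fun x =>
    one_sub_ne_zero (mul_mem_disc (by simp) hz)
  -- The tilted kernel is the Herglotz kernel under the inverse of the affine map in (ii).
  have hker : ∀ x : sphere (0 : ℂ) 1,
      (1 + Complex.exp (-2 * Complex.I * lam) * (x : ℂ) * z) / (1 - (x : ℂ) * z) =
        (Complex.exp (Complex.I * lam))⁻¹ * ((Real.cos lam : ℂ) *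
          ((1 + (x : ℂ) * z) / (1 - (x : ℂ) * z)) + Complex.I * (Real.sin lam : ℂ)) := by
    intro x
    have := hne x
    rw [eq_inv_mul_iff_mul_eq₀ ha]
    have h1 := exp_I_mul_mul_exp_neg_two lam
    generalize Complex.exp (-2 * Complex.I * lam) = e at h1 ⊢
    field_simp
    linear_combination exp_I_mul lam + (x : ℂ) * z * h1
  have hint : Integrable (fun x : sphere (0 : ℂ) 1 => (1 + (x : ℂ) * z) / (1 - (x : ℂ) * z))
      (μ : Measure (sphere (0 : ℂ) 1)) :=
    Continuous.integrable_of_hasCompactSupport (by fun_prop (disch := exact hne))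
      (HasCompactSupport.of_compactSpace _)
  simp_rw [hker]
  rw [integral_const_mul, integral_add (hint.const_mul _) (integrable_const _),
    integral_const_mul, ← hμ z hz, integral_const]
  simp only [probReal_univ, one_smul]
  field_simp
  ring

theorem mem_P_of_integral {lam : ℝ} (hc : 0 < Real.cos lam) {p : ℂ → ℂ} (hp : p ∈ A₀)
    (μ : Measure (sphere (0 : ℂ) 1)) [IsProbabilityMeasure μ]
    (h : ∀ z ∈ disc, p z = ∫ x : sphere (0 : ℂ) 1, pLam lam ((x : ℂ) * z) ∂μ) : p ∈ P lam := by
  refine ⟨hp, fun z hz => ?_⟩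
  have hmem : ∀ x : sphere (0 : ℂ) 1, (x : ℂ) * z ∈ disc := fun x => mul_mem_disc (by simp) hz
  have hcont : Continuous fun x : sphere (0 : ℂ) 1 =>
      Complex.exp (Complex.I * lam) * pLam lam ((x : ℂ) * z) :=
    continuous_const.mul ((pLam_mem_A₀ lam).1.continuousOn.comp_continuous (by fun_prop) hmem)
  have hint := hcont.integrable_of_hasCompactSupport (μ := μ) (HasCompactSupport.of_compactSpace _)
  have hpos : ∀ x : sphere (0 : ℂ) 1,
      0 < (Complex.exp (Complex.I * lam) * pLam lam ((x : ℂ) * z)).re :=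
    fun x => exp_mul_pLam_re_pos hc (hmem x)
  rw [h z hz, ← integral_const_mul]
  have hre : ∫ x : sphere (0 : ℂ) 1, (Complex.exp (Complex.I * lam) * pLam lam ((x : ℂ) * z)).re ∂μ
      = (∫ x : sphere (0 : ℂ) 1, Complex.exp (Complex.I * lam) * pLam lam ((x : ℂ) * z) ∂μ).re :=
    integral_re hint
  rw [← hre]
  refine (integral_pos_iff_support_of_nonneg (fun x => (hpos x).le) hint.re).2 ?_
  have : Function.support (fun x : sphere (0 : ℂ) 1 =>
      (Complex.exp (Complex.I * lam) * pLam lam ((x : ℂ) * z)).re) = Set.univ :=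
    Set.eq_univ_of_forall fun x => (hpos x).ne'
  rw [this]
  simp

theorem mem_P_iff_subordinate {lam : ℝ} (hc : 0 < Real.cos lam) {p : ℂ → ℂ} (hp : p ∈ A₀) :
    p ∈ P lam ↔ Subordinate p (pLam lam) := by
  constructor
  · intro h
    have hne : ∀ z ∈ disc, Complex.exp (-2 * Complex.I * lam) + p z ≠ 0 := fun z hz =>
      exp_add_ne_zero hc (h.2 z hz).le
    -- The solution ω of `pLam lam ω = p z`.
    refine ⟨fun z => (p z - 1) / (Complex.exp (-2 * Complex.I * lam) + p z), fun z hz => ?_,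
      by simp [hp.2], fun z hz => ?_, fun z hz => ?_⟩
    · have := hne z hz
      have := hp.1 z hz
      fun_prop (disch := assumption)
    · rw [norm_div, div_lt_one (norm_pos_iff.2 (hne z hz)), ← norm_neg, neg_sub]
      have h1 := norm_add_sq_sub_norm_sub_sq lam (p z)
      have h2 := mul_pos hc (h.2 z hz)
      exact lt_of_pow_lt_pow_left₀ 2 (norm_nonneg _) (by linarith)
    · have h1 := hne z hz
      have h2 := one_add_exp_ne_zero hc
      rw [pLam]
      generalize Complex.exp (-2 * Complex.I * lam) = e at h1 h2 ⊢
      have h3 : 1 - (p z - 1) / (e + p z) = (1 + e) / (e + p z) := by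
        field_simp
        ring
      rw [h3]
      field_simp
      ring
  · rintro ⟨ω, -, -, hω, hpω⟩
    refine ⟨hp, fun z hz => ?_⟩
    rw [hpω z hz]
    exact exp_mul_pLam_re_pos hc (mem_disc.2 (hω z hz))

theorem mem_P_iff_mem_dual_V {lam : ℝ} (hc : 0 < Real.cos lam) {p : ℂ → ℂ} (hp : p ∈ A₀) :
    p ∈ P lam ↔ p ∈ dual (V lam) := by
  have he := one_add_exp_ne_zero hc
  constructor
  · refine fun h => ⟨hp, ?_⟩
    rintro f ⟨x, hx, rfl⟩ z hz h0
    have hx0 : x ≠ 0 := by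
      rintro rfl
      simp at hx
    rw [hadamard_mobius hp _ hz] at h0
    have h1 : x * (Complex.exp (-2 * Complex.I * lam) + p z) = 1 - p z := by
      generalize Complex.exp (-2 * Complex.I * lam) = e at he h0 ⊢
      field_simp at h0
      linear_combination h0
    have h2 := congrArg norm h1
    rw [norm_mul, hx, one_mul] at h2
    have h3 := norm_add_sq_sub_norm_sub_sq lam (p z)
    rw [h2, sub_self] at h3
    have := mul_pos hc (h.2 z hz)
    linarith
  · refine fun h => ⟨hp, fun z₁ hz₁ => ?_⟩
    by_contra! hneg
    have hcont : ContinuousOn (fun z => (Complex.exp (Complex.I * lam) * p z).re) disc :=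
      Complex.continuous_re.comp_continuousOn (continuousOn_const.mul hp.1.continuousOn)
    have h0 : 0 ≤ (Complex.exp (Complex.I * lam) * p 0).re := by
      rw [hp.2, mul_one, mul_comm, Complex.exp_ofReal_mul_I_re]
      exact hc.le
    have hpre : IsPreconnected disc := (convex_ball (0 : ℂ) 1).isPreconnected
    -- If p leaves the half plane it meets the boundary line; there (1 - p)/(e + p) is unimodular
    -- and names the member of `V lam` whose convolution with p vanishes.
    obtain ⟨z, hz, hz0⟩ := hpre.intermediate_value hz₁ zero_mem_disc hcont ⟨hneg, h0⟩
    have hne := exp_add_ne_zero hc (p := p z) hz0.ge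
    have h1 := norm_add_sq_sub_norm_sub_sq lam (p z)
    simp only at hz0
    rw [hz0, mul_zero, sub_eq_zero] at h1
    have h2 : ‖Complex.exp (-2 * Complex.I * lam) + p z‖ = ‖1 - p z‖ :=
      (pow_left_inj₀ (norm_nonneg _) (norm_nonneg _) two_ne_zero).1 h1
    have hx : ‖(1 - p z) / (Complex.exp (-2 * Complex.I * lam) + p z)‖ = 1 := by
      rw [norm_div, ← h2, div_self (norm_ne_zero_iff.2 hne)]
    have hx0 : 1 - p z ≠ 0 := by
      rw [← norm_ne_zero_iff, ← h2]
      exact norm_ne_zero_iff.2 hne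
    refine h.2 _ ⟨_, hx, rfl⟩ z hz ?_
    rw [hadamard_mobius hp _ hz]
    generalize Complex.exp (-2 * Complex.I * lam) = e at he hne ⊢
    field_simp
    ring

theorem W_subset_P {lam : ℝ} (hc : 0 < Real.cos lam) : W lam ⊆ P lam := by
  rintro f ⟨x, y, t, hx, hy, ht0, ht1, rfl⟩
  have hrot : ∀ x : ℂ, ‖x‖ = 1 → ∀ z ∈ disc,
      0 < (Complex.exp (Complex.I * lam) *
        ((1 + x * Complex.exp (-2 * Complex.I * lam) * z) / (1 - x * z))).re := by
    intro x hx z hz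
    have := exp_mul_pLam_re_pos hc (mul_mem_disc hx hz)
    rwa [pLam, ← mul_assoc, mul_comm _ x] at this
  refine ⟨⟨fun z hz => ?_, by simp⟩, fun z hz => ?_⟩
  · have h1 := one_sub_ne_zero (mul_mem_disc hx hz)
    have h2 := one_sub_ne_zero (mul_mem_disc hy hz)
    fun_prop (disch := assumption)
  · have h1 := hrot x hx z hz
    have h2 := hrot y hy z hz
    rw [mul_add, mul_left_comm, mul_left_comm _ (1 - (t : ℂ)), Complex.add_re,
      Complex.re_ofReal_mul, ← Complex.ofReal_one, ← Complex.ofReal_sub, Complex.re_ofReal_mul]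
    rcases ht0.eq_or_lt with rfl | ht
    · simpa using h2
    · exact add_pos_of_pos_of_nonneg (mul_pos ht h1) (mul_nonneg (sub_nonneg.2 ht1) h2.le)

/-- Convolution is commutative, so this is `W_subset_P` combined with the description of `P lam` as
the dual of `V lam`. -/
theorem V_subset_dual_W {lam : ℝ} (hc : 0 < Real.cos lam) : V lam ⊆ dual (W lam) := by
  intro f hf
  have hfA : f ∈ A₀ := by
    obtain ⟨x, -, rfl⟩ := hf
    exact mobius_mem_A₀ _
  refine ⟨hfA, fun w hw z hz => ?_⟩
  have hwP := W_subset_P hc hw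
  rw [hadamard_comm]
  exact ((mem_P_iff_mem_dual_V hc hwP.1).1 hwP).2 f hf z hz

theorem dual_anti {V₁ V₂ : Set (ℂ → ℂ)} (h : V₁ ⊆ V₂) : dual V₂ ⊆ dual V₁ :=
  fun _ hg => ⟨hg.1, fun f hf => hg.2 f (h hf)⟩

theorem mem_dual_dual_W_of_integral {lam : ℝ} {p : ℂ → ℂ} (hp : p ∈ A₀)
    (μ : Measure (sphere (0 : ℂ) 1)) [IsProbabilityMeasure μ]
    (h : ∀ z ∈ disc, p z = ∫ x : sphere (0 : ℂ) 1, pLam lam ((x : ℂ) * z) ∂μ) :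
    p ∈ dual (dual (W lam)) := by
  refine ⟨hp, fun g hg z hz => ?_⟩
  set e := Complex.exp (-2 * Complex.I * lam) with he
  have hpc : taylorCoeff p = fun n => (∫ x : sphere (0 : ℂ) 1, (x : ℂ) ^ n ∂μ) * mobiusCoeff e n := by
    refine taylorCoeff_of_hasSum fun z hz => ?_
    rw [h z hz, ← taylorCoeff_mobius e]
    exact hasSum_moment_mul_taylorCoeff (pLam_mem_A₀ lam).1 μ hz
  have hH : AnalyticOnNhd ℂ (fun w => 1 + (1 + e) * (g w - 1)) disc := by
    intro w hw
    have := hg.1.1 w hw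
    fun_prop
  have hHc : taylorCoeff (fun w => 1 + (1 + e) * (g w - 1)) =
      fun n => mobiusCoeff e n * taylorCoeff g n :=
    taylorCoeff_of_hasSum fun w hw => hasSum_mobiusCoeff_mul hg.1 e hw
  have hmem : ∀ x : sphere (0 : ℂ) 1, (x : ℂ) * z ∈ disc := fun x => mul_mem_disc (by simp) hz
  -- The factor `mobiusCoeff` moves from p to g, leaving only the moments of μ on the side of p.
  have hval : hadamard g p z = ∫ x : sphere (0 : ℂ) 1, (1 + (1 + e) * (g ((x : ℂ) * z) - 1)) ∂μ := by
    apply hadamard_eq_of_hasSum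
    refine hasSum_of_eq (hasSum_moment_mul_taylorCoeff hH μ hz) (fun n => ?_) rfl
    rw [hpc, hHc]
    ring
  rw [hval]
  have : ConnectedSpace (sphere (0 : ℂ) 1) :=
    isConnected_iff_connectedSpace.1
      (isConnected_sphere (by simp [Complex.rank_real_complex]) 0 zero_le_one)
  refine integral_ne_zero_of_no_opposite μ
    (hH.continuousOn.comp_continuous (by fun_prop) hmem) fun x y t ht0 ht1 h0 => ?_
  have hx : ‖(x : ℂ)‖ = 1 := by simp
  have hy : ‖(y : ℂ)‖ = 1 := by simp
  refine hg.2 _ ⟨x, y, t, hx, hy, ht0, ht1, rfl⟩ z hz ?_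
  rw [hadamard_mobius_mixture hg.1 _ _ _ _ _ hx hy hz]
  exact h0

end TiltedCaratheodory

theorem theorem1 (lam : ℝ) (hlam : lam ∈ Set.Ioo (-(Real.pi / 2)) (Real.pi / 2))
    (p : ℂ → ℂ) (hp : p ∈ TiltedCaratheodory.A₀) :
    List.TFAE [
      p ∈ TiltedCaratheodory.P lam,
      (fun z => (Complex.exp (Complex.I * lam) * p z - Complex.I * (Real.sin lam : ℂ)) /
        (Real.cos lam : ℂ)) ∈ TiltedCaratheodory.P 0,
      ∃ μ : MeasureTheory.Measure (Metric.sphere (0 : ℂ) 1), MeasureTheory.IsProbabilityMeasure μ ∧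
        ∀ z ∈ TiltedCaratheodory.disc,
          p z = ∫ x : Metric.sphere (0 : ℂ) 1,
            (1 + Complex.exp (-2 * Complex.I * lam) * (x : ℂ) * z) / (1 - (x : ℂ) * z) ∂μ,
      TiltedCaratheodory.Subordinate p (TiltedCaratheodory.pLam lam),
      p ∈ TiltedCaratheodory.dual (TiltedCaratheodory.V lam),
      p ∈ TiltedCaratheodory.dual (TiltedCaratheodory.dual (TiltedCaratheodory.W lam))] := by
  have hc : 0 < Real.cos lam := Real.cos_pos_of_mem_Ioo hlam
  tfae_have 1 ↔ 2 := TiltedCaratheodory.mem_P_iff_normalize_mem_P_zero hc hp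
  tfae_have 2 → 3 := TiltedCaratheodory.exists_measure_of_normalize_mem_P_zero hc
  tfae_have 3 → 1 := by
    rintro ⟨μ, hμ, h⟩
    refine TiltedCaratheodory.mem_P_of_integral hc hp μ fun z hz => ?_
    simpa only [TiltedCaratheodory.pLam, mul_assoc] using h z hz
  tfae_have 1 ↔ 4 := TiltedCaratheodory.mem_P_iff_subordinate hc hp
  tfae_have 1 ↔ 5 := TiltedCaratheodory.mem_P_iff_mem_dual_V hc hp
  tfae_have 3 → 6 := by
    rintro ⟨μ, hμ, h⟩
    refine TiltedCaratheodory.mem_dual_dual_W_of_integral hp μ fun z hz => ?_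
    simpa only [TiltedCaratheodory.pLam, mul_assoc] using h z hz
  tfae_have 6 → 5 := fun h =>
    TiltedCaratheodory.dual_anti (TiltedCaratheodory.V_subset_dual_W hc) h
  tfae_finish
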